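/- Let $d\ge 3$, let $\mu$ be the (un-normalized) surface measure on the unit sphere $\mathbb{S}^{d-1}\subset\mathbb{R}^d$, and for $\ell\ge 0$ let $N_\ell$ be the dimension of the space of spherical harmonics of order $\ell$, i.e. of restrictions to $\mathbb{S}^{d-1}$ of real homogeneous harmonic polynomials of degree $\ell$ on $\mathbb{R}^d$. For each $\ell$ let $\{Y_{\ell,m}\}_{m=1}^{N_\ell}$ be any $L^2(\mu)$-orthonormal basis of this space, and let $\Phi=\{Y_{\ell,m}\}_{\ell\ge0,\,1\le m\le N_\ell}$, regarded as a sequence $\{\varphi_k\}_{k=1}^\infty$ in the lexicographic order of $(\ell,m)$. Let $\{\omega_\ell\}_{\ell=0}^\infty$ be a sequence of positive numbers for which there are $C>0$ and $s>d-1$ with $\omega_\ell\ge C\ell^s$ for all sufficiently large $\ell$, and put $\omega_{\ell,m}:=\omega_\ell$, ordered in the same way as a sequence $\{\omega_k\}_{k=1}^\infty$. Then: 1. $\Phi$ and $\omega$ are compatible: $\Phi$ is a sequence of continuous functions that is orthonormal in $L^2(\mu)$, the sequence $\{\omega_k\}$ is positive and diverges to infinity, and the series $K_{\Phi,\omega}(x,y)=\sum_{k=1}^\infty\omega_k^{-1}\varphi_k(x)\varphi_k(y)$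 converges absolutely for all $x,y\in\mathbb{S}^{d-1}$ and uniformly on $\mathbb{S}^{d-1}\times\mathbb{S}^{d-1}$ to a bounded continuous function in $L^2(\mu\times\mu)$. 2. $K_{\Phi,\omega}$ is strictly positive-definite, i.e. it is continuous and symmetric, and $\sum_{j,k=1}^n K_{\Phi,\omega}(x_j,x_k)u_ju_k>0$ for all distinct $x_1,\dots,x_n\in\mathbb{S}^{d-1}$ and all nonzero $u\in\mathbb{R}^n$; and it is an inner product kernel, i.e. $K_{\Phi,\omega}(x,y)$ depends only on $x\cdot y$. 3. Every finite $X\subset\mathbb{S}^{d-1}$ is a sampling set for $\Phi$: there is a natural number $p$ such that for every $y\colon X\to\mathbb{R}$ some $f\in\operatorname{span}\{\varphi_k\}_{k=1}^p$ satisfies $f=y$ on $X$. -/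

import Mathlib

open MeasureTheory Filter Topology

noncomputable section

namespace WeightedInterp

/-! ### Weighted kernels, compatibility and sampling sets on a general space -/

section General

variable {Ω : Type*} [TopologicalSpace Ω] [MeasurableSpace Ω]

/-- The kernel `K_{Φ,ω}(x, y) = ∑ₖ ωₖ⁻¹ φₖ(x) φₖ(y)`.  (The absolute convergence of the series is
part of `Compatible`.) -/
def kernel (φ : ℕ → C(Ω, ℝ)) (w : ℕ → ℝ) (x y : Ω) : ℝ :=
  ∑' k, (w k)⁻¹ * φ k x * φ k y

/-- Compatibility of a sequence of continuous functions `φ` with a sequence of weights `w`: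
the functions are orthonormal in `L²(μ)`, the weights are positive and diverge to infinity, and the
series of the kernel converges absolutely and uniformly to a bounded, continuous, square-integrable
function. -/
structure Compatible (μ : Measure Ω) (φ : ℕ → C(Ω, ℝ)) (w : ℕ → ℝ) : Prop where
  memLp : ∀ k, MemLp (φ k) 2 μ
  orthonormal : ∀ j k, ∫ x, φ j x * φ k x ∂μ = if j = k then 1 else 0
  weight_pos : ∀ k, 0 < w k
  weight_tendsto : Tendsto w atTop atTop
  summable_abs : ∀ x y, Summable fun k => |(w k)⁻¹ * φ k x * φ k y|
  tendstoUniformly : TendstoUniformly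
    (fun (n : ℕ) (z : Ω × Ω) => ∑ k ∈ Finset.range n, (w k)⁻¹ * φ k z.1 * φ k z.2)
    (fun z => kernel φ w z.1 z.2) atTop
  kernel_continuous : Continuous fun z : Ω × Ω => kernel φ w z.1 z.2
  kernel_bounded : ∃ B : ℝ, ∀ x y, |kernel φ w x y| ≤ B
  kernel_memLp : MemLp (fun z : Ω × Ω => kernel φ w z.1 z.2) 2 (μ.prod μ)

/-- A finite set `X` is a sampling set for `φ` if, for some `p`, arbitrary data on `X` can be
interpolated from the span of the first `p` functions. -/
def IsSamplingSet (φ : ℕ → C(Ω, ℝ)) (X : Finset Ω) : Prop :=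
  ∃ p : ℕ, ∀ y : X → ℝ, ∃ f ∈ Submodule.span ℝ (φ '' {k | k < p}), ∀ x : X, f x = y x

/-- Strictly positive-definite kernels: continuous, symmetric, and with a positive quadratic form
on every finite set of distinct points and every nonzero vector. -/
structure IsStrictlyPosDef (K : Ω → Ω → ℝ) : Prop where
  continuous : Continuous fun z : Ω × Ω => K z.1 z.2
  symm : ∀ x y, K x y = K y x
  pos : ∀ (n : ℕ) (x : Fin n → Ω), Function.Injective x → ∀ u : Fin n → ℝ, u ≠ 0 →
    0 < ∑ j, ∑ k, K (x j) (x k) * u j * u k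

end General

/-! ### Lexicographic enumeration of doubly indexed families -/

/-- For block sizes `N 0, N 1, …`, the block that contains the `k`-th pair `(ℓ, m)`, `m < N ℓ`, in
the lexicographic order (everything is counted from `0`). -/
def lexBlock (N : ℕ → ℕ) (k : ℕ) : ℕ :=
  sInf {ℓ | k < ∑ j ∈ Finset.range (ℓ + 1), N j}

/-- The family `a ℓ m`, `m < N ℓ`, as a sequence in the lexicographic order of the pairs `(ℓ, m)`.
(The default value `0` occurs only if the total number of pairs is finite.) -/
def lexSeq {E : Type*} [Zero E] (N : ℕ → ℕ) (a : (ℓ : ℕ) → Fin (N ℓ) → E) (k : ℕ) : E :=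
  if h : k - ∑ j ∈ Finset.range (lexBlock N k), N j < N (lexBlock N k) then
    a (lexBlock N k) ⟨k - ∑ j ∈ Finset.range (lexBlock N k), N j, h⟩
  else 0

theorem lexBlock_add (N : ℕ → ℕ) (ℓ : ℕ) (m : Fin (N ℓ)) :
    lexBlock N ((∑ j ∈ Finset.range ℓ, N j) + m) = ℓ := by
  have hm := m.2
  apply le_antisymm
  · apply Nat.sInf_le
    simp only [Set.mem_ofPred_eq, Finset.sum_range_succ]
    omega
  · apply le_csInf
    · exact ⟨ℓ, by simp only [Set.mem_ofPred_eq, Finset.sum_range_succ]; omega⟩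
    · intro b hb
      by_contra! hlt
      have : ∑ j ∈ Finset.range (b + 1), N j ≤ ∑ j ∈ Finset.range ℓ, N j :=
        Finset.sum_le_sum_of_subset (Finset.range_subset_range.2 hlt)
      simp only [Set.mem_ofPred_eq] at hb
      omega

/-- The pair `(ℓ, m)` is at position `N 0 + ⋯ + N (ℓ - 1) + m`. -/
theorem lexSeq_add {E : Type*} [Zero E] (N : ℕ → ℕ) (a : (ℓ : ℕ) → Fin (N ℓ) → E) (ℓ : ℕ)
    (m : Fin (N ℓ)) : lexSeq N a ((∑ j ∈ Finset.range ℓ, N j) + m) = a ℓ m := by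
  have hb := lexBlock_add N ℓ m
  generalize hk : (∑ j ∈ Finset.range ℓ, N j) + (m : ℕ) = k at hb
  subst hb
  have hm : k - ∑ j ∈ Finset.range (lexBlock N k), N j = m := by omega
  unfold lexSeq
  rw [dif_pos (by rw [hm]; exact m.2)]
  congr 1
  exact Fin.ext hm

/-! ### Spherical harmonics -/

/-- The unit sphere `S^{d-1}` of `ℝ^d`. -/
abbrev Sphere (d : ℕ) : Type := Metric.sphere (0 : EuclideanSpace ℝ (Fin d)) 1

/-- The (un-normalized) surface measure of the unit sphere. -/
def surfaceMeasure (d : ℕ) : Measure (Sphere d) :=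
  (volume : Measure (EuclideanSpace ℝ (Fin d))).toSphere

/-- The Laplace operator `∑ᵢ ∂ᵢ²` on real polynomials in `d` variables. -/
def polyLaplacian (d : ℕ) : MvPolynomial (Fin d) ℝ →ₗ[ℝ] MvPolynomial (Fin d) ℝ :=
  ∑ i, (MvPolynomial.pderiv i).toLinearMap ∘ₗ (MvPolynomial.pderiv i).toLinearMap

/-- Restriction of a polynomial function on `ℝ^d` to the unit sphere. -/
def restrictSphere (d : ℕ) : MvPolynomial (Fin d) ℝ →ₗ[ℝ] C(Sphere d, ℝ) where
  toFun p := ⟨fun x => MvPolynomial.eval (fun i => (x : EuclideanSpace ℝ (Fin d)) i) p, by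
    have := MvPolynomial.continuous_eval p
    fun_prop⟩
  map_add' p q := by ext x; simp
  map_smul' c p := by ext x; simp

/-- The spherical harmonics of order `ℓ`: restrictions to the sphere of the homogeneous harmonic
polynomials of degree `ℓ` (including zero). -/
def sphericalHarmonics (d ℓ : ℕ) : Submodule ℝ C(Sphere d, ℝ) :=
  (MvPolynomial.homogeneousSubmodule (Fin d) ℝ ℓ ⊓ LinearMap.ker (polyLaplacian d)).map
    (restrictSphere d)

/-- The dimension `N_ℓ` of the space of spherical harmonics of order `ℓ`. -/
def harmonicDim (d ℓ : ℕ) : ℕ := Module.finrank ℝ (sphericalHarmonics d ℓ)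

/-- `Y ℓ m`, `m < N_ℓ`, is for each `ℓ` an `L²`-orthonormal basis of the space of spherical
harmonics of order `ℓ`. -/
structure IsHarmonicBasis (d : ℕ) (Y : (ℓ : ℕ) → Fin (harmonicDim d ℓ) → C(Sphere d, ℝ)) :
    Prop where
  span_eq : ∀ ℓ, Submodule.span ℝ (Set.range (Y ℓ)) = sphericalHarmonics d ℓ
  orthonormal : ∀ ℓ m m', ∫ x, Y ℓ m x * Y ℓ m' x ∂surfaceMeasure d = if m = m' then 1 else 0

/-- The spherical harmonics basis as a sequence, in the lexicographic order of `(ℓ, m)`. -/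
def harmonicSeq (d : ℕ) (Y : (ℓ : ℕ) → Fin (harmonicDim d ℓ) → C(Sphere d, ℝ)) :
    ℕ → C(Sphere d, ℝ) :=
  lexSeq (harmonicDim d) Y

/-- Weights that depend only on the order `ℓ`, as a sequence in the lexicographic order of
`(ℓ, m)`. -/
def harmonicWeight (d : ℕ) (ω : ℕ → ℝ) : ℕ → ℝ :=
  lexSeq (harmonicDim d) fun ℓ _ => ω ℓ

/-- Inner product kernels on the sphere: `K x y` depends only on `x · y`. -/
def IsInnerProductKernel {d : ℕ} (K : Sphere d → Sphere d → ℝ) : Prop :=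
  ∃ g : ℝ → ℝ, ∀ x y : Sphere d,
    K x y = g (inner ℝ (x : EuclideanSpace ℝ (Fin d)) (y : EuclideanSpace ℝ (Fin d)))

end WeightedInterp

end

/-! Write r² for the sum of the squared coordinates. Everything rests on four facts about spherical
harmonics.

Density: a homogeneous polynomial is a harmonic one plus r² times one of degree two less
(`exists_harmonic_add_radiusSq_mul`). Since r² = 1 on the sphere, harmonics span all polynomial
functions there, and these interpolate on finite sets.

Size: harmonicity determines a polynomial from its coefficients with one fixed exponent at most 1,
so N_ℓ = O(ℓ^(d-2)) (`harmonicDim_le`).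

Orthogonality: angular derivatives have integral zero by rotation invariance. They supply a Green
identity (`integral_gradDot`) whose symmetry separates the orders.

Invariance: a rotation acts on each order by an orthogonal matrix, so ∑ₘ Y(x)Y(y) is invariant
(`sum_mul_sphereMap`). On the diagonal it is the constant N_ℓ / μ(S).

Thus block ℓ of the kernel is at most N_ℓ / (ω_ℓ μ(S)), summable because s > d - 1; a Weierstrass
test by blocks gives convergence. The quadratic form is a weighted sum of squares, and its vanishing
contradicts interpolation. Invariance of the blocks makes the kernel a function of x · y. -/

namespace WeightedInterp

/-! ### Harmonic decomposition of polynomials -/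

section Polynomials

open MvPolynomial

variable {d : ℕ}

theorem polyLaplacian_apply (p : MvPolynomial (Fin d) ℝ) :
    polyLaplacian d p = ∑ i, pderiv i (pderiv i p) := by
  simp [polyLaplacian, LinearMap.sum_apply]

/-- The polynomial `∑ᵢ xᵢ²`. -/
noncomputable def radiusSq (d : ℕ) : MvPolynomial (Fin d) ℝ := ∑ i, X i * X i

theorem pderiv_radiusSq (i : Fin d) : pderiv i (radiusSq d) = 2 * X i := by
  simp only [radiusSq, map_sum, Derivation.leibniz, pderiv_X, Pi.single_apply, smul_eq_mul]
  simp [Finset.sum_add_distrib, two_mul]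

theorem isHomogeneous_radiusSq : (radiusSq d).IsHomogeneous 2 :=
  IsHomogeneous.sum _ _ _ fun i _ => (isHomogeneous_X ℝ i).mul (isHomogeneous_X ℝ i)

theorem isHomogeneous_polyLaplacian {p : MvPolynomial (Fin d) ℝ} {n : ℕ}
    (hp : p.IsHomogeneous n) : (polyLaplacian d p).IsHomogeneous (n - 2) := by
  rw [polyLaplacian_apply]
  exact IsHomogeneous.sum _ _ _ fun i _ => hp.pderiv.pderiv

/-- Leibniz rule: Δr² = 2d, and the cross term is 4 ∑ xᵢ ∂ᵢp = 4np by Euler's identity. -/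
theorem polyLaplacian_radiusSq_mul {p : MvPolynomial (Fin d) ℝ} {n : ℕ}
    (hp : p.IsHomogeneous n) :
    polyLaplacian d (radiusSq d * p) =
      (2 * d + 4 * n : ℝ) • p + radiusSq d * polyLaplacian d p := by
  have key : ∀ i, pderiv i (pderiv i (radiusSq d * p)) =
      2 * p + 4 * (X i * pderiv i p) + radiusSq d * pderiv i (pderiv i p) := by
    intro i
    have h2 : pderiv i (2 : MvPolynomial (Fin d) ℝ) = 0 := by
      rw [← map_ofNat (C : ℝ →+* MvPolynomial (Fin d) ℝ) 2, pderiv_C]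
    simp only [Derivation.leibniz, map_add, pderiv_radiusSq, smul_eq_mul, h2, pderiv_X_self]
    ring
  rw [polyLaplacian_apply, polyLaplacian_apply, Finset.sum_congr rfl fun i _ => key i,
    Finset.sum_add_distrib, Finset.sum_add_distrib, ← Finset.mul_sum, ← Finset.mul_sum,
    ← Finset.mul_sum, hp.sum_X_mul_pderiv]
  simp only [Finset.sum_const, Finset.card_univ, Fintype.card_fin, smul_eq_C_mul, nsmul_eq_mul,
    map_add, map_mul, map_natCast, map_ofNat]
  ring

theorem polyLaplacian_eq_zero_of_degree_lt_two {n : ℕ} (hn : n < 2) {p : MvPolynomial (Fin d) ℝ}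
    (hp : p.IsHomogeneous n) : polyLaplacian d p = 0 := by
  rw [polyLaplacian_apply]
  refine Finset.sum_eq_zero fun i _ => ?_
  have h1 : (pderiv i p).IsHomogeneous 0 := by
    have := hp.pderiv (i := i)
    rwa [show n - 1 = 0 by omega] at this
  rw [← totalDegree_zero_iff_isHomogeneous, totalDegree_eq_zero_iff_eq_C] at h1
  rw [h1, pderiv_C]

/-- The ansatz q = c⁻¹f + r²q' turns the equation into the same one for q', two degrees lower and
with c increased by 2d + 4m. This is why c is an arbitrary positive number in the induction. -/
theorem exists_smul_add_radiusSq_mul_polyLaplacian (n : ℕ) :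
    ∀ (c : ℝ), 0 < c → ∀ f : MvPolynomial (Fin d) ℝ, f.IsHomogeneous n →
      ∃ q : MvPolynomial (Fin d) ℝ, q.IsHomogeneous n ∧
        c • q + radiusSq d * polyLaplacian d q = f := by
  induction n using Nat.strong_induction_on with
  | _ n ih =>
    intro c hc f hf
    by_cases hn : n < 2
    · refine ⟨c⁻¹ • f, by simpa [smul_eq_C_mul] using (isHomogeneous_C _ c⁻¹).mul hf, ?_⟩
      rw [map_smul, polyLaplacian_eq_zero_of_degree_lt_two hn hf, smul_smul, mul_inv_cancel₀ hc.ne']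
      simp
    · obtain ⟨m, rfl⟩ : ∃ m, n = m + 2 := ⟨n - 2, by omega⟩
      have hL : (polyLaplacian d f).IsHomogeneous m := isHomogeneous_polyLaplacian hf
      obtain ⟨q, hq, hqe⟩ := ih m (by omega) (c + (2 * d + 4 * m)) (by positivity)
        (-(c⁻¹ • polyLaplacian d f))
        (by simpa [smul_eq_C_mul] using ((isHomogeneous_C _ c⁻¹).mul hL).neg)
      refine ⟨c⁻¹ • f + radiusSq d * q, ?_, ?_⟩
      · refine IsHomogeneous.add ?_ ?_
        · simpa [smul_eq_C_mul] using (isHomogeneous_C _ c⁻¹).mul hf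
        · simpa [add_comm] using isHomogeneous_radiusSq.mul hq
      · rw [map_add, polyLaplacian_radiusSq_mul hq, map_smul, smul_add, smul_smul,
          mul_inv_cancel₀ hc.ne', one_smul]
        rw [add_smul] at hqe
        have : c • (radiusSq d * q) = radiusSq d * (c • q) := (mul_smul_comm _ _ _).symm
        rw [this]
        linear_combination (radiusSq d) * hqe

/-- The decomposition of a homogeneous polynomial into a harmonic part and a multiple of `∑ᵢ xᵢ²`. -/
theorem exists_harmonic_add_radiusSq_mul (hd : 0 < d) {n : ℕ} {p : MvPolynomial (Fin d) ℝ}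
    (hp : p.IsHomogeneous (n + 2)) :
    ∃ h q : MvPolynomial (Fin d) ℝ, h.IsHomogeneous (n + 2) ∧ polyLaplacian d h = 0 ∧
      q.IsHomogeneous n ∧ p = h + radiusSq d * q := by
  -- With this constant the equation says Δ(r²q) = Δp; `hd` makes the constant positive also for n =
  -- 0.
  obtain ⟨q, hq, hqe⟩ := exists_smul_add_radiusSq_mul_polyLaplacian n (2 * d + 4 * n)
    (by positivity) (polyLaplacian d p) (isHomogeneous_polyLaplacian hp)
  refine ⟨p - radiusSq d * q, q, hp.sub ?_, ?_, hq, by ring⟩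
  · simpa [add_comm] using isHomogeneous_radiusSq.mul hq
  · rw [map_sub, polyLaplacian_radiusSq_mul hq, hqe, sub_self]

theorem restrictSphere_apply (p : MvPolynomial (Fin d) ℝ) (x : Sphere d) :
    restrictSphere d p x = eval (fun i => (x : EuclideanSpace ℝ (Fin d)) i) p := rfl

theorem eval_radiusSq (x : Sphere d) :
    eval (fun i => (x : EuclideanSpace ℝ (Fin d)) i) (radiusSq d) = 1 := by
  have h : ‖(x : EuclideanSpace ℝ (Fin d))‖ ^ 2 = 1 := by simp
  rw [EuclideanSpace.real_norm_sq_eq] at h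
  simpa [radiusSq, ← pow_two] using h

theorem restrictSphere_mem_sphericalHarmonics {n : ℕ} {p : MvPolynomial (Fin d) ℝ}
    (hp : p.IsHomogeneous n) (h : polyLaplacian d p = 0) :
    restrictSphere d p ∈ sphericalHarmonics d n :=
  Submodule.mem_map_of_mem ⟨hp, h⟩

theorem restrictSphere_homogeneous_mem_iSup (hd : 0 < d) (n : ℕ) :
    ∀ p : MvPolynomial (Fin d) ℝ, p.IsHomogeneous n →
      restrictSphere d p ∈ ⨆ ℓ, sphericalHarmonics d ℓ := by
  induction n using Nat.strong_induction_on with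
  | _ n ih =>
    intro p hp
    by_cases hn : n < 2
    · exact Submodule.mem_iSup_of_mem n
        (restrictSphere_mem_sphericalHarmonics hp (polyLaplacian_eq_zero_of_degree_lt_two hn hp))
    · obtain ⟨m, rfl⟩ : ∃ m, n = m + 2 := ⟨n - 2, by omega⟩
      obtain ⟨h, q, hh, hL, hq, rfl⟩ := exists_harmonic_add_radiusSq_mul hd hp
      have : restrictSphere d (radiusSq d * q) = restrictSphere d q := by
        ext x
        simp [restrictSphere_apply, eval_radiusSq]
      rw [map_add, this]
      exact add_mem (Submodule.mem_iSup_of_mem _ (restrictSphere_mem_sphericalHarmonics hh hL))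
        (ih m (by omega) q hq)

/-- Every polynomial function on the sphere is a sum of spherical harmonics. -/
theorem restrictSphere_mem_iSup (hd : 0 < d) (p : MvPolynomial (Fin d) ℝ) :
    restrictSphere d p ∈ ⨆ ℓ, sphericalHarmonics d ℓ := by
  rw [← sum_homogeneousComponent p, map_sum]
  exact sum_mem fun i _ => restrictSphere_homogeneous_mem_iSup hd i _
    (homogeneousComponent_isHomogeneous i p)

/-! ### Dimension bound -/

theorem coeff_polyLaplacian (p : MvPolynomial (Fin d) ℝ) (e : Fin d →₀ ℕ) :
    coeff e (polyLaplacian d p) =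
      ∑ i, coeff (e + Finsupp.single i 2) p * ((e i + 2) * (e i + 1)) := by
  rw [polyLaplacian_apply, coeff_sum]
  refine Finset.sum_congr rfl fun i _ => ?_
  rw [coeff_pderiv, coeff_pderiv, add_assoc, ← Finsupp.single_add]
  simp
  ring

/-- A harmonic polynomial is determined by the coefficients of the monomials in which a given
variable occurs at most once. -/
theorem eq_zero_of_polyLaplacian_eq_zero (i₀ : Fin d) {p : MvPolynomial (Fin d) ℝ}
    (hp : polyLaplacian d p = 0) (h : ∀ e : Fin d →₀ ℕ, e i₀ ≤ 1 → coeff e p = 0) : p = 0 := by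
  suffices H : ∀ n : ℕ, ∀ e : Fin d →₀ ℕ, e i₀ = n → coeff e p = 0 by
    ext e
    simpa using H _ e rfl
  intro n
  induction n using Nat.strong_induction_on with
  | _ n ih =>
    intro e he
    by_cases hn : n ≤ 1
    · exact h e (he ▸ hn)
    set e' : Fin d →₀ ℕ := e - Finsupp.single i₀ 2 with he'
    have hadd : e' + Finsupp.single i₀ 2 = e := by
      refine tsub_add_cancel_of_le ?_
      rw [Finsupp.single_le_iff]
      omega
    have hval : e' i₀ + 2 = n := by
      rw [← he, ← hadd]
      simp
    -- The coefficient of Δp at e' is a positive multiple of the one of p at e plus terms at e' +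
    -- 2eⱼ, j ≠ i₀, whose i₀-entry is n - 2.
    have hc : coeff e' (polyLaplacian d p) = 0 := by rw [hp, coeff_zero]
    rw [coeff_polyLaplacian, Finset.sum_eq_single i₀, hadd] at hc
    · rcases mul_eq_zero.1 hc with hc | hc
      · exact hc
      · have : (0 : ℝ) < ((e' i₀ : ℝ) + 2) * ((e' i₀ : ℝ) + 1) := by positivity
        exact absurd hc this.ne'
    · intro j _ hj
      rw [ih (e' i₀) (by omega) _ (by simp [hj]), zero_mul]
    · simp

/-- Exponents of degree `ℓ` whose entry at `0` is at most one. -/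
def lowExponents (d ℓ : ℕ) : Set (Fin (d + 2) →₀ ℕ) := {e | e.degree = ℓ ∧ e 0 ≤ 1}

/-- An exponent in `lowExponents` is determined by all its entries but the last. -/
def lowExponentsCode (d ℓ : ℕ) (e : lowExponents d ℓ) : Fin 2 × (Fin d → Fin (ℓ + 1)) :=
  (⟨e.1 0, by have := e.2.2; omega⟩, fun i => ⟨e.1 i.castSucc.succ, by
    have h1 := e.2.1
    have h2 := Finsupp.le_degree i.castSucc.succ e.1
    omega⟩)

theorem lowExponentsCode_injective (d ℓ : ℕ) : Function.Injective (lowExponentsCode d ℓ) := by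
  rintro ⟨e, he, he0⟩ ⟨f, hf, hf0⟩ hef
  simp only [lowExponentsCode, Prod.mk.injEq, Fin.mk.injEq, funext_iff] at hef
  obtain ⟨h0, h1⟩ := hef
  rw [Finsupp.degree_eq_sum, Fin.sum_univ_succ, Fin.sum_univ_castSucc] at he hf
  have hs : ∑ i : Fin d, e i.castSucc.succ = ∑ i : Fin d, f i.castSucc.succ :=
    Finset.sum_congr rfl fun i _ => h1 i
  have hl : e (Fin.last d).succ = f (Fin.last d).succ := by omega
  congr 1
  ext i
  refine Fin.cases h0 (fun i => ?_) i
  exact Fin.lastCases hl h1 i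

/-- Reading off the coefficients at `lowExponents` is injective on harmonic polynomials. In d + 2
variables this leaves d free exponents, hence the power d. -/
theorem finrank_harmonic_le (d ℓ : ℕ) :
    Module.Finite ℝ ↥(homogeneousSubmodule (Fin (d + 2)) ℝ ℓ ⊓ LinearMap.ker (polyLaplacian (d + 2)))
    ∧ Module.finrank ℝ
      ↥(homogeneousSubmodule (Fin (d + 2)) ℝ ℓ ⊓ LinearMap.ker (polyLaplacian (d + 2)))
      ≤ 2 * (ℓ + 1) ^ d := by
  have : Finite (lowExponents d ℓ) := Finite.of_injective _ (lowExponentsCode_injective d ℓ)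
  have := Fintype.ofFinite (lowExponents d ℓ)
  let T : ↥(homogeneousSubmodule (Fin (d + 2)) ℝ ℓ ⊓ LinearMap.ker (polyLaplacian (d + 2))) →ₗ[ℝ]
      (lowExponents d ℓ → ℝ) :=
    (LinearMap.pi fun e => lcoeff ℝ e.1) ∘ₗ Submodule.subtype _
  have hT : Function.Injective T := by
    rw [injective_iff_map_eq_zero]
    rintro ⟨p, hp, hL⟩ h0
    rw [Subtype.ext_iff]
    refine eq_zero_of_polyLaplacian_eq_zero 0 hL fun e he => ?_
    by_cases hdeg : e.degree = ℓ
    · exact congrFun h0 ⟨e, hdeg, he⟩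
    · exact IsHomogeneous.coeff_eq_zero hp hdeg
  refine ⟨Module.Finite.of_injective T hT, (LinearMap.finrank_le_finrank_of_injective hT).trans ?_⟩
  rw [Module.finrank_fintype_fun_eq_card]
  refine (Fintype.card_le_of_injective _ (lowExponentsCode_injective d ℓ)).trans ?_
  simp

theorem harmonicDim_le (hd : 2 ≤ d) (ℓ : ℕ) : harmonicDim d ℓ ≤ 2 * (ℓ + 1) ^ (d - 2) := by
  obtain ⟨d, rfl⟩ : ∃ e, d = e + 2 := ⟨d - 2, by omega⟩
  obtain ⟨hfin, hle⟩ := finrank_harmonic_le d ℓ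
  exact (Submodule.finrank_map_le _ _).trans hle

/-! ### Orthogonal substitutions -/

/-- The polynomial `p ∘ R` for a linear map `R` of `ℝ^d`. -/
noncomputable def polyComp (R : EuclideanSpace ℝ (Fin d) →ₗ[ℝ] EuclideanSpace ℝ (Fin d)) :
    MvPolynomial (Fin d) ℝ →ₐ[ℝ] MvPolynomial (Fin d) ℝ :=
  aeval fun i => ∑ j, C (R (EuclideanSpace.single j 1) i) * X j

theorem eval_polyComp (R : EuclideanSpace ℝ (Fin d) →ₗ[ℝ] EuclideanSpace ℝ (Fin d))
    (p : MvPolynomial (Fin d) ℝ) (x : EuclideanSpace ℝ (Fin d)) :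
    eval (fun i => x i) (polyComp R p) = eval (fun i => R x i) p := by
  have hx : x = ∑ j, x j • EuclideanSpace.single j (1 : ℝ) := by
    ext k
    simp [Finset.sum_apply, Pi.single_apply]
  induction p using MvPolynomial.induction_on with
  | C a => simp [polyComp]
  | add p q hp hq => simp [hp, hq]
  | mul_X p i hp =>
    rw [map_mul, map_mul, map_mul, hp]
    congr 1
    conv_rhs => rw [hx]
    simp [polyComp, map_sum, mul_comm]

theorem isHomogeneous_polyComp (R : EuclideanSpace ℝ (Fin d) →ₗ[ℝ] EuclideanSpace ℝ (Fin d))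
    {p : MvPolynomial (Fin d) ℝ} {n : ℕ} (hp : p.IsHomogeneous n) :
    (polyComp R p).IsHomogeneous n := by
  have := hp.aeval (fun i => ∑ j, C (R (EuclideanSpace.single j 1) i) * X j) (n := 1)
    fun i => IsHomogeneous.sum _ _ _ fun j _ => by
      simpa using (isHomogeneous_C _ _).mul (isHomogeneous_X ℝ j)
  rwa [one_mul] at this

theorem pderiv_polyComp (R : EuclideanSpace ℝ (Fin d) →ₗ[ℝ] EuclideanSpace ℝ (Fin d))
    (p : MvPolynomial (Fin d) ℝ) (i : Fin d) :
    pderiv i (polyComp R p) =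
      ∑ j, C (R (EuclideanSpace.single i 1) j) * polyComp R (pderiv j p) := by
  induction p using MvPolynomial.induction_on with
  | C a => simp [polyComp]
  | add p q hp hq => simp [hp, hq, mul_add, Finset.sum_add_distrib]
  | mul_X p k hp =>
    have hX : pderiv i (polyComp R (X k)) = C (R (EuclideanSpace.single i 1) k) := by
      simp [polyComp, Pi.single_apply]
    have hk : ∀ j, polyComp R (pderiv j (p * X k)) =
        polyComp R p * (if k = j then 1 else 0) + polyComp R (X k) * polyComp R (pderiv j p) := by
      intro j
      rw [Derivation.leibniz, map_add, smul_eq_mul, smul_eq_mul, map_mul, map_mul, pderiv_X,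
        Pi.single_apply]
      congr 2
      split_ifs <;> simp_all
    rw [map_mul, Derivation.leibniz, hX, hp, smul_eq_mul, smul_eq_mul, Finset.mul_sum]
    simp only [hk, mul_add, Finset.sum_add_distrib]
    refine congrArg₂ (· + ·) ?_ ?_
    · simp [mul_comm]
    · exact Finset.sum_congr rfl fun j _ => by ring

/-- Two applications of the chain rule contract the Hessian of p with R Rᵀ, which is the identity.
-/
theorem polyLaplacian_polyComp
    (R : EuclideanSpace ℝ (Fin d) ≃ₗᵢ[ℝ] EuclideanSpace ℝ (Fin d))
    (p : MvPolynomial (Fin d) ℝ) :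
    polyLaplacian d (polyComp R.toLinearEquiv.toLinearMap p) =
      polyComp R.toLinearEquiv.toLinearMap (polyLaplacian d p) := by
  have horth : ∀ j k : Fin d, ∑ i, (R (EuclideanSpace.single i 1) j) *
      (R (EuclideanSpace.single i 1) k) = if j = k then 1 else 0 := by
    intro j k
    have hs := R.symm.inner_map_map (EuclideanSpace.single j (1 : ℝ)) (EuclideanSpace.single k 1)
    -- R⁻¹ = Rᵀ, so that R⁻¹ preserving inner products says that the rows of R are orthonormal.
    have h2 : ∀ i l, R.symm (EuclideanSpace.single l (1 : ℝ)) i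
        = R (EuclideanSpace.single i (1 : ℝ)) l := by
      intro i l
      have := R.inner_map_eq_flip (EuclideanSpace.single i (1 : ℝ)) (EuclideanSpace.single l 1)
      simpa [EuclideanSpace.inner_single_left, EuclideanSpace.inner_single_right] using this.symm
    rw [PiLp.inner_apply, EuclideanSpace.inner_single_left] at hs
    simp only [h2] at hs
    simpa [Pi.single_apply, mul_comm] using hs
  calc polyLaplacian d (polyComp R.toLinearEquiv.toLinearMap p)
      = ∑ i, ∑ j, ∑ k, C (R (EuclideanSpace.single i 1) j * R (EuclideanSpace.single i 1) k) *
          polyComp R.toLinearEquiv.toLinearMap (pderiv k (pderiv j p)) := by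
        rw [polyLaplacian_apply]
        refine Finset.sum_congr rfl fun i _ => ?_
        rw [pderiv_polyComp, map_sum]
        refine Finset.sum_congr rfl fun j _ => ?_
        rw [pderiv_C_mul, pderiv_polyComp, Finset.mul_sum]
        refine Finset.sum_congr rfl fun k _ => ?_
        rw [C_mul, mul_assoc]
        rfl
    _ = ∑ j, ∑ k, C (∑ i, R (EuclideanSpace.single i 1) j * R (EuclideanSpace.single i 1) k) *
          polyComp R.toLinearEquiv.toLinearMap (pderiv k (pderiv j p)) := by
        rw [Finset.sum_comm]
        refine Finset.sum_congr rfl fun j _ => ?_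
        rw [Finset.sum_comm]
        refine Finset.sum_congr rfl fun k _ => ?_
        rw [map_sum, Finset.sum_mul]
    _ = polyComp R.toLinearEquiv.toLinearMap (polyLaplacian d p) := by
        rw [polyLaplacian_apply, map_sum]
        refine Finset.sum_congr rfl fun j _ => ?_
        simp only [horth]
        rw [Finset.sum_eq_single j] <;> simp +contextual [eq_comm]

end Polynomials

/-! ### Rotation invariance of the surface measure and orthogonality of different orders -/

section Rotations

open MvPolynomial
open scoped Pointwise

variable {d : ℕ}

instance : IsFiniteMeasure (surfaceMeasure d) := by
  unfold surfaceMeasure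
  infer_instance

theorem integrable_surfaceMeasure (f : C(Sphere d, ℝ)) : Integrable f (surfaceMeasure d) :=
  f.continuous.integrable_of_hasCompactSupport (HasCompactSupport.of_compactSpace f)

/-- The action of an orthogonal transformation on the sphere. -/
noncomputable def sphereMap (R : EuclideanSpace ℝ (Fin d) ≃ₗᵢ[ℝ] EuclideanSpace ℝ (Fin d)) :
    C(Sphere d, Sphere d) where
  toFun x := ⟨R x, by simp⟩
  continuous_toFun := by
    refine Continuous.subtype_mk ?_ _
    exact R.continuous.comp continuous_subtype_val

@[simp]
theorem coe_sphereMap (R : EuclideanSpace ℝ (Fin d) ≃ₗᵢ[ℝ] EuclideanSpace ℝ (Fin d))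
    (x : Sphere d) : (sphereMap R x : EuclideanSpace ℝ (Fin d)) = R x := rfl

/-- The surface measure of s is d times the volume of the cone (0,1)·s, and R preserves volume and
maps cones to cones. -/
theorem measurePreserving_sphereMap
    (R : EuclideanSpace ℝ (Fin d) ≃ₗᵢ[ℝ] EuclideanSpace ℝ (Fin d)) :
    MeasurePreserving (sphereMap R) (surfaceMeasure d) (surfaceMeasure d) := by
  have hm : Measurable (sphereMap R) := (sphereMap R).continuous.measurable
  refine ⟨hm, Measure.ext fun s hs => ?_⟩
  rw [Measure.map_apply hm hs, surfaceMeasure, Measure.toSphere_apply' _ (hm hs),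
    Measure.toSphere_apply' _ hs]
  congr 1
  have h : Set.Ioo (0 : ℝ) 1 • ((↑) '' (sphereMap R ⁻¹' s) : Set (EuclideanSpace ℝ (Fin d))) =
      R ⁻¹' (Set.Ioo (0 : ℝ) 1 • ((↑) '' s)) := by
    ext x
    simp only [Set.mem_smul, Set.mem_image, Set.mem_preimage]
    constructor
    · rintro ⟨r, hr, _, ⟨y, hy, rfl⟩, rfl⟩
      exact ⟨r, hr, _, ⟨_, hy, rfl⟩, by simp⟩
    · rintro ⟨r, hr, _, ⟨y, hy, rfl⟩, h⟩
      refine ⟨r, hr, _, ⟨sphereMap R.symm y, ?_, rfl⟩, ?_⟩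
      · convert hy
        ext1
        simp
      · apply R.injective
        simp [h]
  rw [h]
  exact R.measurePreserving.measure_preimage_emb R.toHomeomorph.measurableEmbedding _

theorem integral_comp_sphereMap
    (R : EuclideanSpace ℝ (Fin d) ≃ₗᵢ[ℝ] EuclideanSpace ℝ (Fin d)) (f : C(Sphere d, ℝ)) :
    ∫ x, f (sphereMap R x) ∂surfaceMeasure d = ∫ x, f x ∂surfaceMeasure d := by
  rw [← integral_map (measurePreserving_sphereMap R).measurable.aemeasurable
    (f := fun x => f x) f.continuous.aestronglyMeasurable, (measurePreserving_sphereMap R).map_eq]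

theorem comp_sphereMap_mem_sphericalHarmonics
    (R : EuclideanSpace ℝ (Fin d) ≃ₗᵢ[ℝ] EuclideanSpace ℝ (Fin d)) {ℓ : ℕ} {f : C(Sphere d, ℝ)}
    (hf : f ∈ sphericalHarmonics d ℓ) : f.comp (sphereMap R) ∈ sphericalHarmonics d ℓ := by
  obtain ⟨p, ⟨hp, hL⟩, rfl⟩ := hf
  have hL : polyLaplacian d p = 0 := hL
  refine ⟨polyComp R.toLinearEquiv.toLinearMap p, ⟨isHomogeneous_polyComp _ hp, ?_⟩, ?_⟩
  · exact (polyLaplacian_polyComp R p).trans (by rw [hL, map_zero])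
  · ext x
    exact eval_polyComp R.toLinearEquiv.toLinearMap p x

/-- The rotation by the angle `t` in the plane of the coordinates `i ≠ j`, as a function. -/
noncomputable def planeRotFun (i j : Fin d) (t : ℝ) (x : EuclideanSpace ℝ (Fin d)) (k : Fin d) : ℝ :=
  if k = i then Real.cos t * x i - Real.sin t * x j
  else if k = j then Real.sin t * x i + Real.cos t * x j else x k

theorem sum_planeRotFun_sq {i j : Fin d} (hij : i ≠ j) (t : ℝ) (x : EuclideanSpace ℝ (Fin d)) :
    ∑ k, planeRotFun i j t x k ^ 2 = ∑ k, x k ^ 2 := by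
  have h : ∀ k, planeRotFun i j t x k ^ 2 = x k ^ 2 +
      ((if k = i then (Real.cos t * x i - Real.sin t * x j) ^ 2 - x i ^ 2 else 0) +
        (if k = j then (Real.sin t * x i + Real.cos t * x j) ^ 2 - x j ^ 2 else 0)) := by
    intro k
    unfold planeRotFun
    by_cases h1 : k = i
    · subst h1
      simp [hij]
    · by_cases h2 : k = j
      · subst h2
        simp [h1]
      · simp [h1, h2]
  simp only [h, Finset.sum_add_distrib, Finset.sum_ite_eq', Finset.mem_univ, if_true]
  linear_combination (x i ^ 2 + x j ^ 2) * Real.sin_sq_add_cos_sq t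

/-- The rotation by the angle `t` in the plane of the coordinates `i ≠ j`. -/
noncomputable def planeRotation {i j : Fin d} (hij : i ≠ j) (t : ℝ) :
    EuclideanSpace ℝ (Fin d) ≃ₗᵢ[ℝ] EuclideanSpace ℝ (Fin d) :=
  LinearIsometry.toLinearIsometryEquiv
    { toFun := fun x => WithLp.toLp 2 (planeRotFun i j t x)
      map_add' := fun x y => by
        ext k
        simp only [planeRotFun, PiLp.add_apply]
        split_ifs <;> ring
      map_smul' := fun c x => by
        ext k
        simp only [planeRotFun, PiLp.smul_apply, smul_eq_mul, RingHom.id_apply]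
        split_ifs <;> ring
      norm_map' := fun x => by
        have := sum_planeRotFun_sq hij t x
        rw [EuclideanSpace.norm_eq, EuclideanSpace.norm_eq]
        simpa using congrArg Real.sqrt this } rfl

theorem planeRotation_apply {i j : Fin d} (hij : i ≠ j) (t : ℝ) (x : EuclideanSpace ℝ (Fin d))
    (k : Fin d) : planeRotation hij t x k = planeRotFun i j t x k := rfl

theorem hasDerivAt_eval {γ : ℝ → Fin d → ℝ} {γ' : Fin d → ℝ} {t : ℝ}
    (hγ : ∀ i, HasDerivAt (fun s => γ s i) (γ' i) t) (p : MvPolynomial (Fin d) ℝ) :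
    HasDerivAt (fun s => eval (γ s) p) (∑ i, γ' i * eval (γ t) (pderiv i p)) t := by
  induction p using MvPolynomial.induction_on with
  | C a => simpa using hasDerivAt_const t a
  | add p q hp hq =>
    simp only [map_add, mul_add, Finset.sum_add_distrib]
    exact hp.add hq
  | mul_X p k hp =>
    have := hp.mul (hγ k)
    rw [show (fun s => eval (γ s) (p * X k)) = fun s => eval (γ s) p * γ s k by simp]
    refine this.congr_deriv (Eq.symm ?_)
    simp only [Derivation.leibniz, map_add, smul_eq_mul, map_mul, eval_X, mul_add, pderiv_X,
      Finset.sum_add_distrib, Finset.sum_mul]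
    rw [add_comm]
    refine congrArg₂ (· + ·) (Finset.sum_congr rfl fun i _ => by ring) ?_
    rw [Finset.sum_eq_single k]
    · simp [mul_comm]
    · intro b _ hb
      simp [hb.symm]
    · simp

/-- The infinitesimal rotation `xᵢ ∂ⱼ - xⱼ ∂ᵢ`. -/
noncomputable def angularDeriv (i j : Fin d) (p : MvPolynomial (Fin d) ℝ) :
    MvPolynomial (Fin d) ℝ := X i * pderiv j p - X j * pderiv i p

theorem hasDerivAt_eval_planeRotation {i j : Fin d} (hij : i ≠ j) (p : MvPolynomial (Fin d) ℝ)
    (x : EuclideanSpace ℝ (Fin d)) (t : ℝ) :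
    HasDerivAt (fun s => eval (fun k => planeRotation hij s x k) p)
      (eval (fun k => planeRotation hij t x k) (angularDeriv i j p)) t := by
  have h := hasDerivAt_eval (γ := fun s k => planeRotation hij s x k) (t := t)
    (γ' := fun k => if k = i then - planeRotation hij t x j
      else if k = j then planeRotation hij t x i else 0) ?_ p
  · convert h using 1
    simp only [angularDeriv, map_sub, map_mul, eval_X, ite_mul, zero_mul]
    rw [← Finset.add_sum_erase _ _ (Finset.mem_univ i), Finset.sum_eq_single j]
    · simp [hij.symm]
      ring
    · intro b hb hbj
      simp [Finset.ne_of_mem_erase hb, hbj]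
    · simp [hij.symm]
  · intro k
    simp only [planeRotation_apply, planeRotFun]
    by_cases h1 : k = i
    · subst h1
      simp only [if_true, hij.symm, if_false]
      exact (((Real.hasDerivAt_cos t).mul_const (x k)).sub
        ((Real.hasDerivAt_sin t).mul_const (x j))).congr_deriv (by ring)
    · by_cases h2 : k = j
      · subst h2
        simp only [if_true, h1, if_false]
        exact (((Real.hasDerivAt_sin t).mul_const (x i)).add
          ((Real.hasDerivAt_cos t).mul_const (x k))).congr_deriv (by ring)
      · simp only [h1, h2, if_false]
        exact hasDerivAt_const _ _

/-- The integral of p over the rotated sphere does not depend on the angle; differentiate under the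
integral at angle 0. -/
theorem integral_angularDeriv (i j : Fin d) (p : MvPolynomial (Fin d) ℝ) :
    ∫ x, restrictSphere d (angularDeriv i j p) x ∂surfaceMeasure d = 0 := by
  by_cases hij : i = j
  · subst hij
    simp [angularDeriv]
  obtain ⟨B, hB⟩ : ∃ B, ∀ x, ‖restrictSphere d (angularDeriv i j p) x‖ ≤ B :=
    ⟨‖restrictSphere d (angularDeriv i j p)‖, fun x => ContinuousMap.norm_coe_le_norm _ x⟩
  have h := hasDerivAt_integral_of_dominated_loc_of_deriv_le (μ := surfaceMeasure d) (x₀ := (0 : ℝ))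
    (s := Set.univ) (bound := fun _ => B)
    (F := fun t x => restrictSphere d p (sphereMap (planeRotation hij t) x))
    (F' := fun t x => restrictSphere d (angularDeriv i j p) (sphereMap (planeRotation hij t) x))
    Filter.univ_mem
    (Filter.Eventually.of_forall fun t =>
      ((restrictSphere d p).comp (sphereMap (planeRotation hij t))).continuous.aestronglyMeasurable)
    (integrable_surfaceMeasure ((restrictSphere d p).comp (sphereMap (planeRotation hij 0))))
    ((restrictSphere d (angularDeriv i j p)).comp
      (sphereMap (planeRotation hij 0))).continuous.aestronglyMeasurable
    (Filter.Eventually.of_forall fun x t _ => hB _) (integrable_const B)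
    (Filter.Eventually.of_forall fun x t _ => hasDerivAt_eval_planeRotation hij p x t)
  have h2 := h.2
  simp only [integral_comp_sphereMap] at h2
  exact h2.unique (hasDerivAt_const _ _)

/-- The Dirichlet form `∑ᵢ ∂ᵢp ∂ᵢq`. -/
noncomputable def gradDot (p q : MvPolynomial (Fin d) ℝ) : MvPolynomial (Fin d) ℝ :=
  ∑ i, pderiv i p * pderiv i q

theorem gradDot_comm (p q : MvPolynomial (Fin d) ℝ) : gradDot p q = gradDot q p :=
  Finset.sum_congr rfl fun _ _ => mul_comm _ _

/-- A polynomial substitute for the divergence theorem. Harmonicity reduces ∑ ∂ⱼ(q ∂ⱼp) to `gradDot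
p q`, and Euler's identity evaluates the other sums as multiples of pq, with total a - da - (a + b -
1)a. -/
theorem sum_angularDeriv {p q : MvPolynomial (Fin d) ℝ} {a b : ℕ} (hp : p.IsHomogeneous a)
    (hq : q.IsHomogeneous b) (hL : polyLaplacian d p = 0) :
    ∑ i, ∑ j, angularDeriv i j (X i * (q * pderiv j p)) =
      radiusSq d * gradDot p q - C ((a + b + d - 2 : ℝ) * a) * (p * q) := by
  -- Degree 0 is separate because the degree a - 1 of the derivatives is a truncated subtraction.
  rcases Nat.eq_zero_or_pos a with rfl | ha
  · have h0 : ∀ j, pderiv j p = 0 := by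
      intro j
      rw [← totalDegree_zero_iff_isHomogeneous, totalDegree_eq_zero_iff_eq_C] at hp
      rw [hp, pderiv_C]
    simp [gradDot, h0, angularDeriv]
  have hE := hp.sum_X_mul_pderiv
  have hE2 : ∀ j, ∑ i, X i * pderiv i (q * pderiv j p) = (b + (a - 1)) • (q * pderiv j p) :=
    fun j => (hq.mul hp.pderiv).sum_X_mul_pderiv
  have hterm : ∀ i j, angularDeriv i j (X i * (q * pderiv j p)) =
      (if i = j then q * (X i * pderiv i p) else 0)
      + X i * X i * pderiv j (q * pderiv j p) - q * (X j * pderiv j p)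
      - X j * (X i * pderiv i (q * pderiv j p)) := by
    intro i j
    simp only [angularDeriv, Derivation.leibniz (pderiv j) (X i), Derivation.leibniz (pderiv i) (X i),
      pderiv_X, smul_eq_mul]
    by_cases h : i = j
    · subst h
      simp
      ring
    · simp [h]
      ring
  have hgrad : ∑ j, pderiv j (q * pderiv j p) = gradDot p q := by
    have : ∀ j, pderiv j (q * pderiv j p) = q * pderiv j (pderiv j p) + pderiv j p * pderiv j q := by
      intro j
      simp [Derivation.leibniz]
    rw [Finset.sum_congr rfl fun j _ => this j, Finset.sum_add_distrib, ← Finset.mul_sum,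
      ← polyLaplacian_apply, hL, mul_zero, zero_add, gradDot]
  have h1 : ∑ i, ∑ j, (if i = j then q * (X i * pderiv i p) else 0) = q * (a • p) := by
    simp [← hE, Finset.mul_sum]
  have h2 : ∑ i : Fin d, ∑ j, X i * X i * pderiv j (q * pderiv j p) = radiusSq d * gradDot p q := by
    rw [← hgrad, radiusSq, Finset.sum_mul_sum]
  have h3 : ∑ _i : Fin d, ∑ j, q * (X j * pderiv j p) = d • (q * (a • p)) := by
    rw [← hE, Finset.mul_sum]
    simp
  have h4 : ∑ i, ∑ j, X j * (X i * pderiv i (q * pderiv j p)) =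
      (b + (a - 1)) • (q * (a • p)) := by
    rw [Finset.sum_comm]
    simp only [← Finset.mul_sum, hE2]
    rw [← hE, Finset.mul_sum, Finset.smul_sum]
    refine Finset.sum_congr rfl fun j _ => ?_
    simp only [nsmul_eq_mul]
    ring
  simp only [hterm, Finset.sum_sub_distrib, Finset.sum_add_distrib, h1, h2, h3, h4]
  obtain ⟨a, rfl⟩ : ∃ c, a = c + 1 := ⟨a - 1, by omega⟩
  simp only [nsmul_eq_mul, Nat.add_sub_cancel, map_add, map_sub, map_mul, map_natCast, map_ofNat,
    Nat.cast_add, Nat.cast_one, map_one]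
  ring

theorem integral_gradDot {p q : MvPolynomial (Fin d) ℝ} {a b : ℕ} (hp : p.IsHomogeneous a)
    (hq : q.IsHomogeneous b) (hL : polyLaplacian d p = 0) :
    ∫ x, restrictSphere d (gradDot p q) x ∂surfaceMeasure d =
      (a + b + d - 2 : ℝ) * a * ∫ x, restrictSphere d (p * q) x ∂surfaceMeasure d := by
  have h := congrArg (fun r => ∫ x, restrictSphere d r x ∂surfaceMeasure d)
    (sum_angularDeriv hp hq hL)
  simp only [map_sum, ContinuousMap.coe_sum, Finset.sum_apply] at h
  rw [integral_finsetSum _ fun i _ => integrable_finsetSum _ fun j _ => integrable_surfaceMeasure _,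
    Finset.sum_eq_zero] at h
  · rw [← integral_const_mul, ← sub_eq_zero, ← integral_sub (integrable_surfaceMeasure _)
      ((integrable_surfaceMeasure _).const_mul _), h]
    refine integral_congr_ae (Filter.Eventually.of_forall fun x => ?_)
    simp [restrictSphere_apply, eval_radiusSq]
  · intro i _
    rw [integral_finsetSum _ fun j _ => integrable_surfaceMeasure _]
    exact Finset.sum_eq_zero fun j _ => integral_angularDeriv i j _

/-- Spherical harmonics of different orders are orthogonal. -/
theorem integral_mul_eq_zero_of_ne (hd : 3 ≤ d) {a b : ℕ} (hab : a ≠ b) {f g : C(Sphere d, ℝ)}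
    (hf : f ∈ sphericalHarmonics d a) (hg : g ∈ sphericalHarmonics d b) :
    ∫ x, f x * g x ∂surfaceMeasure d = 0 := by
  obtain ⟨p, ⟨hp, hLp⟩, rfl⟩ := hf
  obtain ⟨q, ⟨hq, hLq⟩, rfl⟩ := hg
  have h1 := integral_gradDot hp hq hLp
  have h2 := integral_gradDot hq hp hLq
  rw [gradDot_comm, mul_comm q p, h1] at h2
  have hI : ∫ x, restrictSphere d (p * q) x ∂surfaceMeasure d =
      ∫ x, restrictSphere d p x * restrictSphere d q x ∂surfaceMeasure d := by
    simp [restrictSphere_apply]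
  rw [← hI]
  have hd' : (3 : ℝ) ≤ d := by exact_mod_cast hd
  have hab' : (a : ℝ) - b ≠ 0 := sub_ne_zero.2 (by exact_mod_cast hab)
  have hpos : (0 : ℝ) < a + b + d - 2 := by
    have : (0 : ℝ) ≤ a := a.cast_nonneg
    have : (0 : ℝ) ≤ b := b.cast_nonneg
    linarith
  -- The integral of `gradDot` is symmetric in p and q, so its two evaluations, with factors a and
  -- b, agree.
  have h3 : ((a + b + d - 2 : ℝ) * (a - b)) *
      ∫ x, restrictSphere d (p * q) x ∂surfaceMeasure d = 0 := by
    linear_combination h2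
  exact (mul_eq_zero.1 h3).resolve_left (mul_ne_zero hpos.ne' hab')

end Rotations

/-! ### Rotation-invariant sums over one order -/

section Zonal

variable {d : ℕ}

/-- Two pairs of unit vectors with the same inner product are related by an orthogonal map. -/
theorem exists_sphereMap_eq {x y x' y' : Sphere d}
    (h : inner ℝ (x : EuclideanSpace ℝ (Fin d)) (y : EuclideanSpace ℝ (Fin d)) =
      inner ℝ (x' : EuclideanSpace ℝ (Fin d)) (y' : EuclideanSpace ℝ (Fin d))) :
    ∃ R : EuclideanSpace ℝ (Fin d) ≃ₗᵢ[ℝ] EuclideanSpace ℝ (Fin d),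
      sphereMap R x = x' ∧ sphereMap R y = y' := by
  set R₁ := (ℝ ∙ ((x : EuclideanSpace ℝ (Fin d)) - x'))ᗮ.reflection
  have h₁ : R₁ x = x' := Submodule.reflection_sub (by simp)
  set R₂ := (ℝ ∙ (R₁ (y : EuclideanSpace ℝ (Fin d)) - y'))ᗮ.reflection
  have h₂ : R₂ (R₁ y) = y' := Submodule.reflection_sub (by simp)
  -- Since R₁ is an isometry with R₁x = x', the hypothesis makes R₁y - y' orthogonal to x'; the
  -- second reflection does not move x'.
  have h₃ : R₂ x' = x' := by
    refine Submodule.reflection_mem_subspace_eq_self ?_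
    rw [Submodule.mem_orthogonal_singleton_iff_inner_right, inner_sub_left, ← h₁,
      R₁.inner_map_map, real_inner_comm, h, h₁, real_inner_comm, sub_self]
  refine ⟨R₁.trans R₂, Subtype.ext ?_, Subtype.ext ?_⟩
  · simp [h₁, h₃]
  · simp [h₂]

variable {Y : (ℓ : ℕ) → Fin (harmonicDim d ℓ) → C(Sphere d, ℝ)}

/-- The reproducing kernel of the spherical harmonics of order `ℓ` is rotation invariant. -/
theorem sum_mul_sphereMap (hY : IsHarmonicBasis d Y) (ℓ : ℕ)
    (R : EuclideanSpace ℝ (Fin d) ≃ₗᵢ[ℝ] EuclideanSpace ℝ (Fin d)) (x y : Sphere d) :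
    ∑ m, Y ℓ m (sphereMap R x) * Y ℓ m (sphereMap R y) = ∑ m, Y ℓ m x * Y ℓ m y := by
  have hmem : ∀ m, ∃ c : Fin (harmonicDim d ℓ) → ℝ,
      ∑ k, c k • Y ℓ k = (Y ℓ m).comp (sphereMap R) := by
    intro m
    rw [← Submodule.mem_span_range_iff_exists_fun, hY.span_eq]
    refine comp_sphereMap_mem_sphericalHarmonics R ?_
    rw [← hY.span_eq]
    exact Submodule.subset_span ⟨m, rfl⟩
  choose c hc using hmem
  have hval : ∀ m z, Y ℓ m (sphereMap R z) = ∑ k, c m k * Y ℓ k z := by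
    intro m z
    have := DFunLike.congr_fun (hc m) z
    simpa [ContinuousMap.coe_sum, Finset.sum_apply] using this.symm
  -- The rotated basis is still orthonormal, so the rows of c are; c is square, so the columns are
  -- too.
  have horth : Matrix.of c * (Matrix.of c).transpose = 1 := by
    ext m m'
    have h := integral_comp_sphereMap R (Y ℓ m * Y ℓ m')
    simp only [ContinuousMap.mul_apply, hY.orthonormal ℓ m m', hval, Finset.sum_mul_sum] at h
    have hint : ∀ i j, Integrable (fun x => c m i * Y ℓ i x * (c m' j * Y ℓ j x))
        (surfaceMeasure d) := fun i j =>
      integrable_surfaceMeasure ((c m i • Y ℓ i) * (c m' j • Y ℓ j))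
    rw [Matrix.one_apply, ← h, Matrix.mul_apply,
      integral_finsetSum _ fun i _ => integrable_finsetSum _ fun j _ => hint i j]
    refine Finset.sum_congr rfl fun i _ => ?_
    rw [integral_finsetSum _ fun j _ => hint i j, Finset.sum_eq_single i]
    · have := hY.orthonormal ℓ i i
      simp only [mul_mul_mul_comm, integral_const_mul, this]
      simp
    · intro j _ hj
      have := hY.orthonormal ℓ i j
      rw [if_neg hj.symm] at this
      simp only [mul_mul_mul_comm, integral_const_mul, this, mul_zero]
    · simp
  have horth' : ∀ k l, ∑ m, c m k * c m l = if k = l then 1 else 0 := by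
    intro k l
    have := congrArg (fun A => A k l) (mul_eq_one_comm.1 horth)
    simpa [Matrix.mul_apply, Matrix.one_apply] using this
  calc ∑ m, Y ℓ m (sphereMap R x) * Y ℓ m (sphereMap R y)
      = ∑ m, ∑ k, ∑ l, (c m k * c m l) * (Y ℓ k x * Y ℓ l y) := by
        refine Finset.sum_congr rfl fun m _ => ?_
        rw [hval, hval, Finset.sum_mul_sum]
        simp only [mul_mul_mul_comm]
    _ = ∑ k, ∑ l, (∑ m, c m k * c m l) * (Y ℓ k x * Y ℓ l y) := by
        rw [Finset.sum_comm]
        refine Finset.sum_congr rfl fun k _ => ?_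
        rw [Finset.sum_comm]
        simp only [Finset.sum_mul]
    _ = ∑ m, Y ℓ m x * Y ℓ m y := by simp [horth']

theorem surfaceMeasure_real_univ_pos (hd : 0 < d) : 0 < (surfaceMeasure d).real Set.univ := by
  have : NeZero d := ⟨hd.ne'⟩
  have : NeZero (surfaceMeasure d) := ⟨by unfold surfaceMeasure; exact Measure.toSphere_ne_zero _⟩
  exact measureReal_univ_pos

/-- The sum is constant because rotations act transitively, and its integral is N_ℓ by
normalization. -/
theorem sum_sq_eq (hd : 0 < d) (hY : IsHarmonicBasis d Y) (ℓ : ℕ) (x : Sphere d) :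
    ∑ m, Y ℓ m x ^ 2 = harmonicDim d ℓ / (surfaceMeasure d).real Set.univ := by
  have hconst : ∀ z, ∑ m, Y ℓ m z * Y ℓ m z = ∑ m, Y ℓ m x * Y ℓ m x := by
    intro z
    obtain ⟨R, hR, -⟩ := exists_sphereMap_eq (x := x) (y := x) (x' := z) (y' := z) (by simp)
    rw [← hR, sum_mul_sphereMap hY]
  have h : ∫ z, ∑ m, Y ℓ m z * Y ℓ m z ∂surfaceMeasure d = harmonicDim d ℓ := by
    have hint : ∀ m, Integrable (fun z => Y ℓ m z * Y ℓ m z) (surfaceMeasure d) :=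
      fun m => integrable_surfaceMeasure (Y ℓ m * Y ℓ m)
    rw [integral_finsetSum _ fun m _ => hint m]
    simp [hY.orthonormal]
  simp only [hconst, integral_const, smul_eq_mul] at h
  rw [eq_div_iff (surfaceMeasure_real_univ_pos hd).ne', ← h, mul_comm]
  simp only [pow_two]

theorem sum_abs_mul_le (hd : 0 < d) (hY : IsHarmonicBasis d Y) (ℓ : ℕ) (x y : Sphere d) :
    ∑ m, |Y ℓ m x * Y ℓ m y| ≤ harmonicDim d ℓ / (surfaceMeasure d).real Set.univ := by
  have h : ∀ m, |Y ℓ m x * Y ℓ m y| ≤ (Y ℓ m x ^ 2 + Y ℓ m y ^ 2) / 2 := by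
    intro m
    rw [abs_le]
    constructor <;> nlinarith [sq_nonneg (Y ℓ m x - Y ℓ m y), sq_nonneg (Y ℓ m x + Y ℓ m y)]
  refine (Finset.sum_le_sum fun m _ => h m).trans ?_
  rw [← Finset.sum_div, Finset.sum_add_distrib, sum_sq_eq hd hY, sum_sq_eq hd hY]
  linarith

end Zonal

/-! ### Sums in lexicographic order -/

section Lex

variable {N : ℕ → ℕ}

/-- When the block sizes have unbounded sums, every index comes from a genuine pair, so the default
value of `lexSeq` is never taken. -/
theorem exists_eq_sum_range_add (hN : ∀ B, ∃ L, B < ∑ j ∈ Finset.range L, N j) (k : ℕ) :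
    ∃ (ℓ : ℕ) (m : Fin (N ℓ)), k = (∑ j ∈ Finset.range ℓ, N j) + m := by
  obtain ⟨L, hL⟩ := hN k
  induction L with
  | zero => simp at hL
  | succ L ih =>
    by_cases h : k < ∑ j ∈ Finset.range L, N j
    · exact ih h
    · rw [Finset.sum_range_succ] at hL
      exact ⟨L, ⟨k - ∑ j ∈ Finset.range L, N j, by omega⟩, by simp; omega⟩

theorem sum_range_sum_range (N : ℕ → ℕ) (a : ℕ → ℝ) (L : ℕ) :
    ∑ k ∈ Finset.range (∑ j ∈ Finset.range L, N j), a k =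
      ∑ ℓ ∈ Finset.range L, ∑ m : Fin (N ℓ), a ((∑ j ∈ Finset.range ℓ, N j) + m) := by
  induction L with
  | zero => simp
  | succ L ih => rw [Finset.sum_range_succ, Finset.sum_range_add, ih, Finset.sum_range_succ,
      Finset.sum_range fun m => a (_ + m)]

theorem le_lexBlock (hN : ∀ B, ∃ L, B < ∑ j ∈ Finset.range L, N j) {L k : ℕ}
    (h : ∑ j ∈ Finset.range L, N j ≤ k) : L ≤ lexBlock N k := by
  obtain ⟨ℓ, m, rfl⟩ := exists_eq_sum_range_add hN k
  rw [lexBlock_add]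
  by_contra! hlt
  have : ∑ j ∈ Finset.range (ℓ + 1), N j ≤ ∑ j ∈ Finset.range L, N j :=
    Finset.sum_le_sum_of_subset (Finset.range_subset_range.2 hlt)
  rw [Finset.sum_range_succ] at this
  have := m.2
  omega

theorem tendsto_sum_range_atTop (hN : ∀ B, ∃ L, B < ∑ j ∈ Finset.range L, N j) :
    Tendsto (fun L => ∑ j ∈ Finset.range L, N j) atTop atTop :=
  tendsto_atTop_atTop_of_monotone
    (fun _ _ h => Finset.sum_le_sum_of_subset (Finset.range_subset_range.2 h))
    fun B => (hN B).imp fun _ h => h.le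

variable {a M : ℕ → ℝ}

/-- Enlarge the range to end at a block boundary beyond L and bound each later block by M. L = 0
gives summability, general L the tail estimate. -/
theorem sum_range_abs_le_of_blocks (hN : ∀ B, ∃ L, B < ∑ j ∈ Finset.range L, N j)
    (hM0 : ∀ ℓ, 0 ≤ M ℓ) (hM : Summable M)
    (ha : ∀ ℓ, ∑ m : Fin (N ℓ), |a ((∑ j ∈ Finset.range ℓ, N j) + m)| ≤ M ℓ) (L n : ℕ) :
    ∑ k ∈ Finset.range n, |a k| ≤
      ∑ k ∈ Finset.range (∑ j ∈ Finset.range L, N j), |a k| + ∑' ℓ, M (ℓ + L) := by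
  obtain ⟨L', hL'⟩ := hN n
  have hle : n ≤ ∑ j ∈ Finset.range (L + L'), N j :=
    hL'.le.trans (Finset.sum_le_sum_of_subset (Finset.range_subset_range.2 (by omega)))
  calc ∑ k ∈ Finset.range n, |a k|
      ≤ ∑ k ∈ Finset.range (∑ j ∈ Finset.range (L + L'), N j), |a k| :=
        Finset.sum_le_sum_of_subset_of_nonneg (Finset.range_subset_range.2 hle)
          fun _ _ _ => abs_nonneg _
    _ ≤ _ := by
        rw [sum_range_sum_range, sum_range_sum_range, Finset.sum_range_add]
        gcongr
        refine (Finset.sum_le_sum fun ℓ _ => ha (L + ℓ)).trans ?_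
        simp only [add_comm L]
        exact ((summable_nat_add_iff L).2 hM).sum_le_tsum _ fun _ _ => hM0 _

theorem summable_abs_of_blocks (hN : ∀ B, ∃ L, B < ∑ j ∈ Finset.range L, N j)
    (hM0 : ∀ ℓ, 0 ≤ M ℓ) (hM : Summable M)
    (ha : ∀ ℓ, ∑ m : Fin (N ℓ), |a ((∑ j ∈ Finset.range ℓ, N j) + m)| ≤ M ℓ) :
    Summable fun k => |a k| :=
  summable_of_sum_range_le (fun _ => abs_nonneg _)
    fun n => sum_range_abs_le_of_blocks hN hM0 hM ha 0 n

theorem abs_tsum_sub_sum_range_le_of_blocks (hN : ∀ B, ∃ L, B < ∑ j ∈ Finset.range L, N j)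
    (hM0 : ∀ ℓ, 0 ≤ M ℓ) (hM : Summable M)
    (ha : ∀ ℓ, ∑ m : Fin (N ℓ), |a ((∑ j ∈ Finset.range ℓ, N j) + m)| ≤ M ℓ) {L n : ℕ}
    (hn : ∑ j ∈ Finset.range L, N j ≤ n) :
    |∑' k, a k - ∑ k ∈ Finset.range n, a k| ≤ ∑' ℓ, M (ℓ + L) := by
  have hs := summable_abs_of_blocks hN hM0 hM ha
  have hs' : Summable fun k => |a (k + n)| := (summable_nat_add_iff n).2 hs
  have h1 := hs.of_abs.sum_add_tsum_nat_add n
  have h2 := hs.sum_add_tsum_nat_add n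
  have h3 : ∑' k, |a k| ≤ _ := hs.tsum_le_of_sum_range_le
    fun n => sum_range_abs_le_of_blocks hN hM0 hM ha L n
  have h4 : ∑ k ∈ Finset.range (∑ j ∈ Finset.range L, N j), |a k| ≤
      ∑ k ∈ Finset.range n, |a k| :=
    Finset.sum_le_sum_of_subset_of_nonneg (Finset.range_subset_range.2 hn)
      fun _ _ _ => abs_nonneg _
  have h5 : |∑' k, a (k + n)| ≤ ∑' k, |a (k + n)| := by
    simpa [Real.norm_eq_abs] using norm_tsum_le_tsum_norm (f := fun k => a (k + n)) hs'
  rw [← h1, add_sub_cancel_left]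
  linarith

/-- Weierstrass test with one majorant per block: the tail of M bounds the error for every z at
once, also when n lies inside a block. -/
theorem tendstoUniformly_of_blocks {Z : Type*} {a : ℕ → Z → ℝ}
    (hN : ∀ B, ∃ L, B < ∑ j ∈ Finset.range L, N j)
    (hM0 : ∀ ℓ, 0 ≤ M ℓ) (hM : Summable M)
    (ha : ∀ z ℓ, ∑ m : Fin (N ℓ), |a ((∑ j ∈ Finset.range ℓ, N j) + m) z| ≤ M ℓ) :
    TendstoUniformly (fun (n : ℕ) z => ∑ k ∈ Finset.range n, a k z) (fun z => ∑' k, a k z)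
      atTop := by
  rw [Metric.tendstoUniformly_iff]
  intro ε hε
  obtain ⟨L, hL⟩ := ((tendsto_sum_nat_add M).eventually (gt_mem_nhds hε)).exists
  filter_upwards [eventually_ge_atTop (∑ j ∈ Finset.range L, N j)] with n hn z
  rw [Real.dist_eq]
  exact (abs_tsum_sub_sum_range_le_of_blocks hN hM0 hM (ha z) hn).trans_lt hL

end Lex

/-! ### Sampling sets -/

section Sampling

open MvPolynomial

variable {d : ℕ}

/-- Polynomials interpolate the indicator function of a point in a finite set. -/
theorem exists_poly_indicator (X : Finset (Sphere d)) (x₀ : Sphere d) :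
    ∃ p : MvPolynomial (Fin d) ℝ, restrictSphere d p x₀ = 1 ∧
      ∀ x ∈ X, x ≠ x₀ → restrictSphere d p x = 0 := by
  classical
  let D : Sphere d → MvPolynomial (Fin d) ℝ := fun x =>
    ∑ i, (MvPolynomial.X i - C ((x : EuclideanSpace ℝ (Fin d)) i)) ^ 2
  have hD : ∀ x z, restrictSphere d (D x) z =
      ‖(z : EuclideanSpace ℝ (Fin d)) - (x : EuclideanSpace ℝ (Fin d))‖ ^ 2 := by
    intro x z
    simp [D, restrictSphere_apply, EuclideanSpace.real_norm_sq_eq]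
  let P := ∏ x ∈ X.erase x₀, D x
  have hP : ∀ z, restrictSphere d P z = ∏ x ∈ X.erase x₀, restrictSphere d (D x) z := by
    intro z
    simp [P, restrictSphere_apply, map_prod]
  have h0 : restrictSphere d P x₀ ≠ 0 := by
    rw [hP, Finset.prod_ne_zero_iff]
    intro x hx
    rw [hD]
    have : (x₀ : EuclideanSpace ℝ (Fin d)) - x ≠ 0 :=
      sub_ne_zero.2 fun h => Finset.ne_of_mem_erase hx (Subtype.ext h.symm)
    positivity
  refine ⟨(restrictSphere d P x₀)⁻¹ • P, ?_, fun x hx hne => ?_⟩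
  · simp [h0]
  · rw [map_smul, ContinuousMap.smul_apply, hP x,
      Finset.prod_eq_zero (Finset.mem_erase.2 ⟨hne, hx⟩), smul_zero]
    simp [hD]

variable {Y : (ℓ : ℕ) → Fin (harmonicDim d ℓ) → C(Sphere d, ℝ)}

/-- The spans of initial segments increase, so membership in their supremum is reached at a finite
stage. -/
theorem mem_span_harmonicSeq (hd : 0 < d) (hY : IsHarmonicBasis d Y)
    (p : MvPolynomial (Fin d) ℝ) :
    ∃ n, restrictSphere d p ∈ Submodule.span ℝ (harmonicSeq d Y '' {k | k < n}) := by
  have hmono : Monotone fun n : ℕ => Submodule.span ℝ (harmonicSeq d Y '' {k | k < n}) :=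
    fun _ _ h => Submodule.span_mono (Set.image_mono fun k (hk : k < _) => hk.trans_le h)
  rw [← Submodule.mem_iSup_of_directed _ hmono.directed_le]
  refine (iSup_le fun ℓ => ?_ : ⨆ ℓ, sphericalHarmonics d ℓ ≤ _) (restrictSphere_mem_iSup hd p)
  rw [← hY.span_eq, Submodule.span_le]
  rintro _ ⟨m, rfl⟩
  refine Submodule.mem_iSup_of_mem ((∑ j ∈ Finset.range ℓ, harmonicDim d j) + m + 1) ?_
  refine Submodule.subset_span ⟨(∑ j ∈ Finset.range ℓ, harmonicDim d j) + m, ?_, ?_⟩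
  · exact Nat.lt_succ_self _
  · exact lexSeq_add _ _ _ _

/-- Lagrange interpolation with the indicator polynomials; finitely many of them fit into one
initial span. -/
theorem isSamplingSet_harmonicSeq (hd : 0 < d) (hY : IsHarmonicBasis d Y)
    (X : Finset (Sphere d)) : IsSamplingSet (harmonicSeq d Y) X := by
  choose P hP1 hP0 using exists_poly_indicator X
  choose n hn using fun x => mem_span_harmonicSeq hd hY (P x)
  refine ⟨X.sup n, fun y => ⟨∑ x : X, y x • restrictSphere d (P x), ?_, fun x => ?_⟩⟩
  · refine sum_mem fun x _ => Submodule.smul_mem _ _ ?_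
    exact Submodule.span_mono (Set.image_mono fun k (hk : k < _) =>
      hk.trans_le (Finset.le_sup (f := n) x.2)) (hn x)
  · rw [ContinuousMap.coe_sum, Finset.sum_apply, Finset.sum_eq_single x]
    · simp [hP1]
    · intro z _ hz
      simp [hP0 z x x.2 fun h => hz (Subtype.ext h.symm)]
    · simp

/-- For d ≥ 2 the sphere is connected and contains the two distinct points e and -e. -/
theorem infinite_sphere (hd : 2 ≤ d) : Infinite (Sphere d) := by
  have hrank : 1 < Module.rank ℝ (EuclideanSpace ℝ (Fin d)) := by
    rw [← Module.finrank_eq_rank, finrank_euclideanSpace_fin]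
    exact_mod_cast hd
  have hpre := isPreconnected_sphere hrank (0 : EuclideanSpace ℝ (Fin d)) 1
  refine Set.infinite_coe_iff.2 (hpre.infinite_of_nontrivial ?_)
  let e : EuclideanSpace ℝ (Fin d) := EuclideanSpace.single ⟨0, by omega⟩ 1
  have he : ‖e‖ = 1 := by simp [e]
  refine ⟨e, by simp [he], -e, by simp [he], fun h => ?_⟩
  have h' : e + e = 0 := eq_neg_iff_add_eq_zero.1 h
  rw [← two_smul ℝ e, smul_eq_zero_iff_right two_ne_zero] at h'
  simp [h'] at he

/-- There are infinitely many spherical harmonics. -/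
theorem exists_lt_sum_harmonicDim (hd : 2 ≤ d) (hY : IsHarmonicBasis d Y) (B : ℕ) :
    ∃ L, B < ∑ j ∈ Finset.range L, harmonicDim d j := by
  classical
  by_contra! hB
  -- Past the last pair `lexBlock` is the infimum of the empty set, namely 0, and k is at least N₀,
  -- so the default value 0 is taken.
  have hzero : ∀ k, B ≤ k → harmonicSeq d Y k = 0 := by
    intro k hk
    have hblock : lexBlock (harmonicDim d) k = 0 := by
      rw [lexBlock, Nat.sInf_eq_zero]
      right
      ext ℓ
      simpa using (hB (ℓ + 1)).trans hk
    have h1 := hB 1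
    rw [harmonicSeq, lexSeq, dif_neg]
    rw [hblock]
    simp at h1 ⊢
    omega
  have := infinite_sphere hd
  obtain ⟨X, hX⟩ := Infinite.exists_subset_card_eq (Sphere d) (B + 1)
  obtain ⟨p, hp⟩ := isSamplingSet_harmonicSeq (by omega) hY X
  let S : Finset C(Sphere d, ℝ) := (Finset.range B).image (harmonicSeq d Y)
  have hle : Submodule.span ℝ (harmonicSeq d Y '' {k | k < p}) ≤ Submodule.span ℝ S := by
    rw [Submodule.span_le]
    rintro _ ⟨k, -, rfl⟩
    by_cases hk : k < B
    · exact Submodule.subset_span (by simpa [S] using ⟨k, hk, rfl⟩)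
    · rw [hzero k (by omega)]
      exact zero_mem _
  let T : Submodule.span ℝ (S : Set C(Sphere d, ℝ)) →ₗ[ℝ] (X → ℝ) :=
    { toFun := fun f x => f.1 x
      map_add' := fun f g => rfl
      map_smul' := fun c f => rfl }
  -- At most B functions would then interpolate arbitrary data at B + 1 points.
  have hT : Function.Surjective T := by
    intro y
    obtain ⟨f, hf, hfy⟩ := hp y
    exact ⟨⟨f, hle hf⟩, funext hfy⟩
  have h1 := LinearMap.finrank_le_finrank_of_surjective hT
  have h2 : Module.finrank ℝ (Submodule.span ℝ (S : Set C(Sphere d, ℝ))) ≤ S.card :=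
    finrank_span_finset_le_card S
  have h3 : S.card ≤ B := Finset.card_image_le.trans (by simp)
  rw [Module.finrank_fintype_fun_eq_card, Fintype.card_coe] at h1
  omega

end Sampling

/-! ### Compatibility of the harmonics and the weights -/

section Main

variable {d : ℕ} {Y : (ℓ : ℕ) → Fin (harmonicDim d ℓ) → C(Sphere d, ℝ)} {ω : ℕ → ℝ}

/-- The contribution of the order `ℓ` to the kernel is at most this. -/
noncomputable def blockBound (d : ℕ) (ω : ℕ → ℝ) (ℓ : ℕ) : ℝ :=
  (ω ℓ)⁻¹ * (harmonicDim d ℓ / (surfaceMeasure d).real Set.univ)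

theorem blockBound_nonneg (hω : ∀ ℓ, 0 < ω ℓ) (ℓ : ℕ) : 0 ≤ blockBound d ω ℓ := by
  have := (hω ℓ).le
  unfold blockBound
  positivity

/-- The bound is O(ℓ^(d-2-s)), and d - 2 - s < -1 is exactly the condition s > d - 1. -/
theorem summable_blockBound (hd : 2 ≤ d) (hω : ∀ ℓ, 0 < ω ℓ) {C s : ℝ} (hC : 0 < C)
    (hs : (d : ℝ) - 1 < s) (hgrowth : ∀ᶠ ℓ : ℕ in atTop, C * (ℓ : ℝ) ^ s ≤ ω ℓ) :
    Summable (blockBound d ω) := by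
  set V := (surfaceMeasure d).real Set.univ
  have hV : 0 < V := surfaceMeasure_real_univ_pos (by omega)
  have hsum : Summable fun ℓ : ℕ =>
      (C⁻¹ * (2 * 2 ^ (d - 2) / V)) * (ℓ : ℝ) ^ (((d - 2 : ℕ) : ℝ) - s) := by
    refine Summable.mul_left _ (Real.summable_nat_rpow.2 ?_)
    push_cast [Nat.cast_sub hd]
    linarith
  refine hsum.of_norm_bounded_eventually_nat ?_
  filter_upwards [hgrowth, eventually_ge_atTop 1] with ℓ hℓ h1
  have hℓ0 : (0 : ℝ) < ℓ := by exact_mod_cast h1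
  have hpow : (0 : ℝ) < (ℓ : ℝ) ^ s := Real.rpow_pos_of_pos hℓ0 s
  -- The factor 2^(d-2) comes from ℓ + 1 ≤ 2ℓ.
  have hdim : (harmonicDim d ℓ : ℝ) ≤ 2 * (2 ^ (d - 2) * (ℓ : ℝ) ^ (d - 2)) := by
    have h := harmonicDim_le hd ℓ
    have h' : (harmonicDim d ℓ : ℝ) ≤ 2 * ((ℓ : ℝ) + 1) ^ (d - 2) := by exact_mod_cast h
    refine h'.trans ?_
    rw [← mul_pow]
    gcongr
    have : (1 : ℝ) ≤ ℓ := by exact_mod_cast h1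
    linarith
  rw [Real.norm_of_nonneg (blockBound_nonneg hω ℓ)]
  calc blockBound d ω ℓ
      ≤ (C * (ℓ : ℝ) ^ s)⁻¹ * ((2 * (2 ^ (d - 2) * (ℓ : ℝ) ^ (d - 2))) / V) := by
        unfold blockBound
        gcongr
    _ = (C⁻¹ * (2 * 2 ^ (d - 2) / V)) * (ℓ : ℝ) ^ (((d - 2 : ℕ) : ℝ) - s) := by
        rw [Real.rpow_sub hℓ0, Real.rpow_natCast]
        field_simp

theorem harmonicSeq_add (Y : (ℓ : ℕ) → Fin (harmonicDim d ℓ) → C(Sphere d, ℝ)) (ℓ : ℕ)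
    (m : Fin (harmonicDim d ℓ)) :
    harmonicSeq d Y ((∑ j ∈ Finset.range ℓ, harmonicDim d j) + m) = Y ℓ m :=
  lexSeq_add _ _ _ _

theorem harmonicWeight_add (ω : ℕ → ℝ) (ℓ : ℕ) (m : Fin (harmonicDim d ℓ)) :
    harmonicWeight d ω ((∑ j ∈ Finset.range ℓ, harmonicDim d j) + m) = ω ℓ :=
  lexSeq_add _ _ _ _

theorem sum_block_le (hd : 0 < d) (hY : IsHarmonicBasis d Y) (hω : ∀ ℓ, 0 < ω ℓ)
    (x y : Sphere d) (ℓ : ℕ) :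
    ∑ m : Fin (harmonicDim d ℓ),
      |(harmonicWeight d ω ((∑ j ∈ Finset.range ℓ, harmonicDim d j) + m))⁻¹ *
        harmonicSeq d Y ((∑ j ∈ Finset.range ℓ, harmonicDim d j) + m) x *
        harmonicSeq d Y ((∑ j ∈ Finset.range ℓ, harmonicDim d j) + m) y| ≤ blockBound d ω ℓ := by
  have hpos := inv_pos.2 (hω ℓ)
  simp only [harmonicSeq_add, harmonicWeight_add, mul_assoc]
  simp only [abs_mul (ω ℓ)⁻¹, abs_of_pos hpos, ← Finset.mul_sum]
  exact mul_le_mul_of_nonneg_left (sum_abs_mul_le hd hY ℓ x y) hpos.le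

theorem integral_harmonicSeq_mul (hd : 3 ≤ d) (hY : IsHarmonicBasis d Y) (j k : ℕ) :
    ∫ x, harmonicSeq d Y j x * harmonicSeq d Y k x ∂surfaceMeasure d = if j = k then 1 else 0 := by
  have hN := exists_lt_sum_harmonicDim (by omega) hY
  obtain ⟨a, m, rfl⟩ := exists_eq_sum_range_add hN j
  obtain ⟨b, m', rfl⟩ := exists_eq_sum_range_add hN k
  rw [harmonicSeq_add, harmonicSeq_add]
  by_cases hab : a = b
  · subst hab
    rw [hY.orthonormal]
    simp [Fin.ext_iff]
  · have hmem : ∀ ℓ m, Y ℓ m ∈ sphericalHarmonics d ℓ := fun ℓ m => by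
      rw [← hY.span_eq]
      exact Submodule.subset_span ⟨m, rfl⟩
    rw [integral_mul_eq_zero_of_ne hd hab (hmem a m) (hmem b m'), if_neg]
    intro h
    apply hab
    rw [← lexBlock_add (harmonicDim d) a m, h, lexBlock_add]

theorem tendsto_harmonicWeight (hd : 2 ≤ d) (hY : IsHarmonicBasis d Y) {C s : ℝ} (hC : 0 < C)
    (hs : (d : ℝ) - 1 < s) (hgrowth : ∀ᶠ ℓ : ℕ in atTop, C * (ℓ : ℝ) ^ s ≤ ω ℓ) :
    Tendsto (harmonicWeight d ω) atTop atTop := by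
  have hN := exists_lt_sum_harmonicDim hd hY
  have hd' : (2 : ℝ) ≤ d := by exact_mod_cast hd
  have hω : Tendsto ω atTop atTop :=
    tendsto_atTop_mono' _ hgrowth (((tendsto_rpow_atTop (by linarith)).comp
      tendsto_natCast_atTop_atTop).const_mul_atTop hC)
  have hblock : Tendsto (lexBlock (harmonicDim d)) atTop atTop :=
    tendsto_atTop.2 fun L => (eventually_ge_atTop _).mono fun k hk => le_lexBlock hN hk
  refine (hω.comp hblock).congr fun k => ?_
  obtain ⟨ℓ, m, rfl⟩ := exists_eq_sum_range_add hN k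
  rw [Function.comp_apply, lexBlock_add, harmonicWeight_add]

theorem compatible_harmonicSeq (hd : 3 ≤ d) (hY : IsHarmonicBasis d Y) (hω : ∀ ℓ, 0 < ω ℓ)
    {C s : ℝ} (hC : 0 < C) (hs : (d : ℝ) - 1 < s)
    (hgrowth : ∀ᶠ ℓ : ℕ in atTop, C * (ℓ : ℝ) ^ s ≤ ω ℓ) :
    Compatible (surfaceMeasure d) (harmonicSeq d Y) (harmonicWeight d ω) := by
  have hN := exists_lt_sum_harmonicDim (by omega) hY
  have hsum := summable_blockBound (by omega) hω hC hs hgrowth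
  have hblock := sum_block_le (by omega) hY hω
  have hunif : TendstoUniformly
      (fun (n : ℕ) (z : Sphere d × Sphere d) => ∑ k ∈ Finset.range n,
        (harmonicWeight d ω k)⁻¹ * harmonicSeq d Y k z.1 * harmonicSeq d Y k z.2)
      (fun z => kernel (harmonicSeq d Y) (harmonicWeight d ω) z.1 z.2) atTop :=
    tendstoUniformly_of_blocks hN (blockBound_nonneg hω) hsum fun z ℓ => hblock z.1 z.2 ℓ
  have hcont : Continuous fun z : Sphere d × Sphere d =>
      kernel (harmonicSeq d Y) (harmonicWeight d ω) z.1 z.2 :=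
    hunif.continuous (Frequently.of_forall fun n => by fun_prop)
  have hbdd : ∀ x y, |kernel (harmonicSeq d Y) (harmonicWeight d ω) x y| ≤
      ∑' ℓ, blockBound d ω (ℓ + 0) := by
    intro x y
    have := abs_tsum_sub_sum_range_le_of_blocks
      (a := fun k => (harmonicWeight d ω k)⁻¹ * harmonicSeq d Y k x * harmonicSeq d Y k y)
      hN (blockBound_nonneg hω) hsum (hblock x y) (L := 0) (n := 0) (by simp)
    simpa [kernel] using this
  exact
    { memLp := fun k => MemLp.of_bound (harmonicSeq d Y k).continuous.aestronglyMeasurable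
        ‖harmonicSeq d Y k‖ (Eventually.of_forall fun x => ContinuousMap.norm_coe_le_norm _ x)
      orthonormal := integral_harmonicSeq_mul hd hY
      weight_pos := fun k => by
        obtain ⟨ℓ, m, rfl⟩ := exists_eq_sum_range_add hN k
        rw [harmonicWeight_add]
        exact hω ℓ
      weight_tendsto := tendsto_harmonicWeight (by omega) hY hC hs hgrowth
      summable_abs := fun x y =>
        summable_abs_of_blocks hN (blockBound_nonneg hω) hsum (hblock x y)
      tendstoUniformly := hunif
      kernel_continuous := hcont
      kernel_bounded := ⟨_, hbdd⟩
      kernel_memLp := MemLp.of_bound hcont.aestronglyMeasurable _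
        (Eventually.of_forall fun z => hbdd z.1 z.2) }

end Main

/-! ### Strict positive-definiteness from sampling -/

section StrictlyPosDef

variable {Ω : Type*} [TopologicalSpace Ω] [MeasurableSpace Ω]

/-- The kernel of a compatible pair is strictly positive-definite if all finite sets are sampling
sets. -/
theorem Compatible.isStrictlyPosDef {μ : Measure Ω} {φ : ℕ → C(Ω, ℝ)} {w : ℕ → ℝ}
    (h : Compatible μ φ w) (hφ : ∀ X : Finset Ω, IsSamplingSet φ X) :
    IsStrictlyPosDef (kernel φ w) where
  continuous := h.kernel_continuous
  symm x y := tsum_congr fun k => by ring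
  pos n x hx u hu := by
    classical
    -- The finite double sum may be exchanged with the series; each term then becomes a weighted
    -- square.
    have hK : HasSum (fun i => (w i)⁻¹ * (∑ j, u j * φ i (x j)) ^ 2)
        (∑ j, ∑ k, kernel φ w (x j) (x k) * u j * u k) := by
      have h1 : ∀ j k, HasSum (fun i => (w i)⁻¹ * φ i (x j) * φ i (x k) * u j * u k)
          (kernel φ w (x j) (x k) * u j * u k) := fun j k =>
        (((h.summable_abs (x j) (x k)).of_abs.hasSum).mul_right _).mul_right _
      refine (hasSum_sum fun j _ => hasSum_sum fun k _ => h1 j k).congr_fun fun i => ?_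
      rw [pow_two, Finset.sum_mul_sum, Finset.mul_sum]
      refine Finset.sum_congr rfl fun j _ => ?_
      rw [Finset.mul_sum]
      exact Finset.sum_congr rfl fun k _ => by ring
    have hnonneg : ∀ i, 0 ≤ (w i)⁻¹ * (∑ j, u j * φ i (x j)) ^ 2 := fun i =>
      mul_nonneg (inv_pos.2 (h.weight_pos i)).le (sq_nonneg _)
    refine (hK.nonneg hnonneg).lt_of_ne fun h0 => hu ?_
    rw [← h0, hasSum_zero_iff_of_nonneg hnonneg] at hK
    have hvanish : ∀ i, ∑ j, u j * φ i (x j) = 0 := fun i => by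
      have := congrFun hK i
      simpa [(h.weight_pos i).ne'] using this
    have hspan : ∀ f ∈ Submodule.span ℝ (Set.range φ), ∑ j, u j * f (x j) = 0 := by
      intro f hf
      induction hf using Submodule.span_induction with
      | mem f hf =>
        obtain ⟨i, rfl⟩ := hf
        exact hvanish i
      | zero => simp
      | add f g _ _ hf hg => simp [mul_add, Finset.sum_add_distrib, hf, hg]
      | smul c f _ hf =>
        simp only [ContinuousMap.smul_apply, smul_eq_mul, mul_left_comm _ c, ← Finset.mul_sum, hf,
          mul_zero]
    obtain ⟨p, hp⟩ := hφ (Finset.univ.image x)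
    -- Interpolating u itself at the points, well defined since they are distinct, turns the
    -- vanishing functional into ∑ uⱼ² = 0.
    obtain ⟨f, hf, hfu⟩ := hp fun z => ∑ j, if x j = z then u j else 0
    have hval : ∀ j, f (x j) = u j := fun j => by
      have := hfu ⟨x j, by simp⟩
      simpa [hx.eq_iff] using this
    have hsq := hspan f (Submodule.span_mono (Set.image_subset_range _ _) hf)
    simp only [hval] at hsq
    rw [Finset.sum_eq_zero_iff_of_nonneg fun j _ => mul_self_nonneg _] at hsq
    ext j
    simpa using hsq j (Finset.mem_univ j)

end StrictlyPosDef

/-! ### Dependence on x · y only -/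

section InnerProduct

variable {d : ℕ} {Y : (ℓ : ℕ) → Fin (harmonicDim d ℓ) → C(Sphere d, ℝ)} {ω : ℕ → ℝ}

/-- Rotations mix the functions of one order, so single terms are not invariant; the partial sums
ending at block boundaries are, and they converge to the kernel. -/
theorem kernel_sphereMap (hd : 2 ≤ d) (hY : IsHarmonicBasis d Y)
    (h : Compatible (surfaceMeasure d) (harmonicSeq d Y) (harmonicWeight d ω))
    (R : EuclideanSpace ℝ (Fin d) ≃ₗᵢ[ℝ] EuclideanSpace ℝ (Fin d)) (x y : Sphere d) :
    kernel (harmonicSeq d Y) (harmonicWeight d ω) (sphereMap R x) (sphereMap R y) =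
      kernel (harmonicSeq d Y) (harmonicWeight d ω) x y := by
  have hT := tendsto_sum_range_atTop (exists_lt_sum_harmonicDim hd hY)
  have hlim : ∀ x y, Tendsto
      (fun L => ∑ ℓ ∈ Finset.range L, (ω ℓ)⁻¹ * ∑ m, Y ℓ m x * Y ℓ m y) atTop
      (𝓝 (kernel (harmonicSeq d Y) (harmonicWeight d ω) x y)) := by
    intro x y
    refine ((h.summable_abs x y).of_abs.hasSum.tendsto_sum_nat.comp hT).congr fun L => ?_
    rw [Function.comp_apply, sum_range_sum_range]
    refine Finset.sum_congr rfl fun ℓ _ => ?_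
    simp only [harmonicSeq_add, harmonicWeight_add, Finset.mul_sum, mul_assoc]
  refine tendsto_nhds_unique (hlim _ _) ((hlim x y).congr fun L => ?_)
  simp only [sum_mul_sphereMap hY]

/-- Any pair with inner product t may define g(t), since such pairs form one orbit; the value 0
serves only for t that no pair attains. -/
theorem isInnerProductKernel_of_sphereMap {K : Sphere d → Sphere d → ℝ}
    (hK : ∀ R x y, K (sphereMap R x) (sphereMap R y) = K x y) : IsInnerProductKernel K := by
  classical
  refine ⟨fun t => if h : ∃ z : Sphere d × Sphere d,
    inner ℝ (z.1 : EuclideanSpace ℝ (Fin d)) (z.2 : EuclideanSpace ℝ (Fin d)) = t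
      then K h.choose.1 h.choose.2 else 0, fun x y => ?_⟩
  have h : ∃ z : Sphere d × Sphere d,
    inner ℝ (z.1 : EuclideanSpace ℝ (Fin d)) (z.2 : EuclideanSpace ℝ (Fin d)) =
      inner ℝ (x : EuclideanSpace ℝ (Fin d)) (y : EuclideanSpace ℝ (Fin d)) := ⟨(x, y), rfl⟩
  refine Eq.trans ?_ (dif_pos h).symm
  obtain ⟨R, h1, h2⟩ := exists_sphereMap_eq h.choose_spec
  rw [← hK R h.choose.1, h1, h2]

end InnerProduct

end WeightedInterp

theorem mainTheorem8 (d : ℕ) (hd : 3 ≤ d)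
    (Y : (ℓ : ℕ) → Fin (WeightedInterp.harmonicDim d ℓ) → C(WeightedInterp.Sphere d, ℝ))
    (hY : WeightedInterp.IsHarmonicBasis d Y)
    (ω : ℕ → ℝ) (hω : ∀ ℓ, 0 < ω ℓ)
    (C s : ℝ) (hC : 0 < C) (hs : (d : ℝ) - 1 < s)
    (hgrowth : ∀ᶠ ℓ : ℕ in Filter.atTop, C * (ℓ : ℝ) ^ s ≤ ω ℓ) :
    WeightedInterp.Compatible (WeightedInterp.surfaceMeasure d)
        (WeightedInterp.harmonicSeq d Y) (WeightedInterp.harmonicWeight d ω) ∧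
      WeightedInterp.IsStrictlyPosDef
        (WeightedInterp.kernel (WeightedInterp.harmonicSeq d Y)
          (WeightedInterp.harmonicWeight d ω)) ∧
      WeightedInterp.IsInnerProductKernel
        (WeightedInterp.kernel (WeightedInterp.harmonicSeq d Y)
          (WeightedInterp.harmonicWeight d ω)) ∧
      ∀ X : Finset (WeightedInterp.Sphere d),
        WeightedInterp.IsSamplingSet (WeightedInterp.harmonicSeq d Y) X := by
  have hcomp := WeightedInterp.compatible_harmonicSeq hd hY hω hC hs hgrowth
  have hsamp := WeightedInterp.isSamplingSet_harmonicSeq (by omega) hY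
  exact ⟨hcomp, hcomp.isStrictlyPosDef hsamp, WeightedInterp.isInnerProductKernel_of_sphereMap
    (WeightedInterp.kernel_sphereMap (by omega) hY hcomp), hsamp⟩
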